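/- Setting. Let $S$ (states, e.g. lattice positions with orientations) and $U$ (control actions) be finite sets. Let $Q(s^+,s,u)\ge 0$, with $\sum_{s^+}Q(s^+,s,u)=1$, be the probability of moving from $s$ to $s^+$ under action $u$, and let $F\subseteq S$ be a set of forbidden states. A (memoryless) policy is a function $K(u,s)\ge 0$ with $\sum_u K(u,s)=1$ for all $s$. It induces the Markov chain $(S_k)_{k\ge 0}$ on $S$ with transition probabilities $Q_K(s^+,s)=\sum_u Q(s^+,s,u)K(u,s)$, whose law we denote by $P_K$. A state $s$ is recurrent under $K$ if $P_K(S_k=s\text{ for some }k>0\mid S_0=s)=1$; $S^R_K$ is the set of these states. A state $s$ is $F$-safe under $K$ if $P_K(S_k\in F\text{ for some }k\ge 0\mid S_0=s)=0$. Let $S^R_{K,F}$ be the set of $F$-safe states in $S^R_K$, let $S^R_F=\bigcup_K S^R_{K,F}$ (union over all policies), and let $\mathbb K^R_F$ be the set of policies $K$ with $S^R_{K,F}=S^R_F$. For $s_0\in S$ let $S^{ps}_{s_0,K}=\{s\in S^R_K : P_K(S_k=s\text{ for some }k>0\mid S_0=s_0)=1\}$, and let $S^{ps}_{s_0,K,F}$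 be the set of its $F$-safe elements. For $s_0\in S^R_K$ the set $S^{ps}_{s_0,K}$ is the recurrent class of $s_0$; for $s_0\in S^R_{K,F}$ the set $S^{ps}_{s_0,K,F}$ is called an $F$-safe recurrent class. Let $n_K$ be the number of distinct $F$-safe recurrent classes under $K$. Suppose that $f^*$ maximizes the entropy $-\sum_{s,u} f(s,u)\ln f(s,u)$ (with $0\ln 0=0$) over all probability mass functions $f$ on $S\times U$ such that $\sum_{u^+} f(s^+,u^+)=\sum_{s,u}Q(s^+,s,u)f(s,u)$ for all $s^+\in S$ and $\sum_u f(s,u)=0$ for all $s\in F$. Put $f^*_S(s)=\sum_u f^*(s,u)$, and let $K^*(u,s)=f^*(s,u)/f^*_S(s)$ if $f^*_S(s)>0$ and $K^*(u,s)=G(u,s)$ otherwise, where $G$ is an arbitrary policy. Proposition. (i) $K^*\in\mathbb K^R_F$, and $n_{K^*}\le n_K$ for every $K\in\mathbb K^R_F$. (ii) If moreover $S^R_{K^*}=S^R_F$, then for every $K\in\mathbb K^R_F$ the total number of recurrent classes under $K^*$ is at most the total number of recurrent classes under $K$. (iii) $n_{K^*}$ is the minimum number of robots needed for maximal $F$-safe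 persistent surveillance: it is the least $r$ for which there are a policy $K$ and states $s^1,\dots,s^r$ with $\bigcup_{i=1}^r S^{ps}_{s^i,K,F}=S^R_F$, and for $r=n_{K^*}$ such states exist with $K=K^*$. -/

import Mathlib

open MeasureTheory ProbabilityTheory

noncomputable section

namespace Surveillance

/-- The dynamics of a robot: `Q s' s u` is the probability of moving to state `s'` when the
control action `u` is applied in state `s`. -/
structure Dynamics (S U : Type*) [Fintype S] where
  toFun : S → S → U → ℝ
  nonneg : ∀ s' s u, 0 ≤ toFun s' s u
  sum_eq_one : ∀ s u, ∑ s', toFun s' s u = 1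

instance {S U : Type*} [Fintype S] : CoeFun (Dynamics S U) (fun _ => S → S → U → ℝ) :=
  ⟨Dynamics.toFun⟩

/-- A memoryless (possibly randomized) control policy: `K u s` is the probability of applying the
action `u` in state `s`. -/
structure Policy (S U : Type*) [Fintype U] where
  toFun : U → S → ℝ
  nonneg : ∀ u s, 0 ≤ toFun u s
  sum_eq_one : ∀ s, ∑ u, toFun u s = 1

instance {S U : Type*} [Fintype U] : CoeFun (Policy S U) (fun _ => U → S → ℝ) :=
  ⟨Policy.toFun⟩

section ClosedLoop

variable {S U : Type*} [Fintype S] [Fintype U]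

/-- The closed-loop transition probability from `s` to `s'` under the policy `K`. -/
def closedLoop (Q : Dynamics S U) (K : Policy S U) (s' s : S) : ℝ :=
  ∑ u, Q s' s u * K u s

theorem closedLoop_nonneg (Q : Dynamics S U) (K : Policy S U) (s' s : S) :
    0 ≤ closedLoop Q K s' s :=
  Finset.sum_nonneg fun u _ => mul_nonneg (Q.nonneg s' s u) (K.nonneg u s)

theorem sum_closedLoop (Q : Dynamics S U) (K : Policy S U) (s : S) :
    ∑ s', closedLoop Q K s' s = 1 := by
  unfold closedLoop
  rw [Finset.sum_comm]
  simp_rw [← Finset.sum_mul, Q.sum_eq_one, one_mul]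
  exact K.sum_eq_one s

/-- The law of the next state, given the current state `s`, under the policy `K`. -/
def stepPMF (Q : Dynamics S U) (K : Policy S U) (s : S) : PMF S :=
  PMF.ofFintype (fun s' => ENNReal.ofReal (closedLoop Q K s' s)) (by
    rw [← ENNReal.ofReal_sum_of_nonneg fun s' _ => closedLoop_nonneg Q K s' s,
      sum_closedLoop, ENNReal.ofReal_one])

variable [MeasurableSpace S] [DiscreteMeasurableSpace S]

/-- The closed-loop transition kernel, as a kernel on histories `(S₀, …, Sₙ)` that depends on the
last state only. -/
def stepKernel (Q : Dynamics S U) (K : Policy S U) (n : ℕ) :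
    Kernel (Finset.Iic n → S) S where
  toFun h := (stepPMF Q K (h ⟨n, Finset.mem_Iic.2 le_rfl⟩)).toMeasure
  measurable' := measurable_of_countable _

instance (Q : Dynamics S U) (K : Policy S U) (n : ℕ) : IsMarkovKernel (stepKernel Q K n) :=
  ⟨fun h => PMF.toMeasure.isProbabilityMeasure
    (stepPMF Q K (h ⟨n, Finset.mem_Iic.2 le_rfl⟩))⟩

/-- The law of the whole trajectory `(S₀, S₁, S₂, …)` of the closed-loop Markov chain under the
policy `K`, started at `S₀ = s₀`. -/
def chainLaw (Q : Dynamics S U) (K : Policy S U) (s₀ : S) : Measure (ℕ → S) :=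
  Kernel.traj (X := fun _ => S) (stepKernel Q K) 0 (fun _ => s₀)

/-- The probability that `S_k = s` for some `k > 0`, given that `S₀ = s₀`. -/
def hitProb (Q : Dynamics S U) (K : Policy S U) (s₀ s : S) : ENNReal :=
  chainLaw Q K s₀ {ω | ∃ k > 0, ω k = s}

/-- The set of recurrent states under the policy `K`. -/
def recurrent (Q : Dynamics S U) (K : Policy S U) : Set S :=
  {s | hitProb Q K s s = 1}

/-- The set of states that are persistently surveilled under the policy `K` by a robot with
initial state `s₀`. -/
def surveilled (Q : Dynamics S U) (K : Policy S U) (s₀ : S) : Set S :=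
  {s | s ∈ recurrent Q K ∧ hitProb Q K s₀ s = 1}

/-- A state is `F`-safe under the policy `K` if the chain started there visits the forbidden set
`F` with probability zero. -/
def IsSafe (Q : Dynamics S U) (K : Policy S U) (F : Set S) (s : S) : Prop :=
  chainLaw Q K s {ω | ∃ k, ω k ∈ F} = 0

/-- The set of `F`-safe recurrent states under the policy `K`. -/
def safeRecurrent (Q : Dynamics S U) (K : Policy S U) (F : Set S) : Set S :=
  {s | s ∈ recurrent Q K ∧ IsSafe Q K F s}

/-- The set of `F`-safe persistently surveilled states under the policy `K` and the initial state
`s₀`. -/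
def safeSurveilled (Q : Dynamics S U) (K : Policy S U) (F : Set S) (s₀ : S) : Set S :=
  {s | s ∈ surveilled Q K s₀ ∧ IsSafe Q K F s}

/-- The maximal set of `F`-safe recurrent states: the states that are recurrent and `F`-safe under
some policy. -/
def maxSafeRecurrent (Q : Dynamics S U) (F : Set S) : Set S :=
  ⋃ K : Policy S U, safeRecurrent Q K F

/-- The policies whose set of `F`-safe recurrent states is maximal. -/
def maximalPolicies (Q : Dynamics S U) (F : Set S) : Set (Policy S U) :=
  {K | safeRecurrent Q K F = maxSafeRecurrent Q F}

/-- The recurrent classes of the closed-loop chain under the policy `K`: the recurrent class of a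
recurrent state `s₀` is the set of states persistently surveilled from `s₀`. -/
def recurrentClasses (Q : Dynamics S U) (K : Policy S U) : Set (Set S) :=
  {C | ∃ s₀ ∈ recurrent Q K, C = surveilled Q K s₀}

/-- The `F`-safe recurrent classes under the policy `K`, which partition the set of `F`-safe
recurrent states. -/
def safeRecurrentClasses (Q : Dynamics S U) (K : Policy S U) (F : Set S) : Set (Set S) :=
  {C | ∃ s₀ ∈ safeRecurrent Q K F, C = safeSurveilled Q K F s₀}

/-- The number of distinct `F`-safe recurrent classes under the policy `K`. -/
def numSafeClasses (Q : Dynamics S U) (K : Policy S U) (F : Set S) : ℕ :=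
  (safeRecurrentClasses Q K F).ncard

end ClosedLoop

section EntropyProgram

variable {S U : Type*} [Fintype S] [Fintype U]

/-- The marginal on states of a probability mass function on state-action pairs. -/
def marginal (f : stdSimplex ℝ (S × U)) (s : S) : ℝ :=
  ∑ u, f.1 (s, u)

/-- The support of the marginal on states. -/
def marginalSupport (f : stdSimplex ℝ (S × U)) : Set S :=
  {s | 0 < marginal f s}

/-- The Shannon entropy `-∑ f ln f`, with the convention `0 ln 0 = 0`. -/
def entropy (f : stdSimplex ℝ (S × U)) : ℝ :=
  ∑ u, ∑ s, Real.negMulLog (f.1 (s, u))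

/-- The constraints of the convex program: `f` is invariant for the dynamics, and gives no mass to
forbidden states. -/
def IsFeasible (Q : Dynamics S U) (F : Set S) (f : stdSimplex ℝ (S × U)) : Prop :=
  (∀ s', ∑ u', f.1 (s', u') = ∑ s, ∑ u, Q s' s u * f.1 (s, u)) ∧
    ∀ s ∈ F, ∑ u, f.1 (s, u) = 0

/-- `f` is an optimal solution of the convex program: it maximizes the entropy among the feasible
probability mass functions. -/
def IsOptimal (Q : Dynamics S U) (F : Set S) (f : stdSimplex ℝ (S × U)) : Prop :=
  IsFeasible Q F f ∧ ∀ g : stdSimplex ℝ (S × U), IsFeasible Q F g → entropy g ≤ entropy f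

open Classical in
/-- The policy derived from `f`: the conditional distribution of the action given the state on the
support of the marginal of `f`, and the arbitrary policy `G` elsewhere. -/
def derivedPolicy (f : stdSimplex ℝ (S × U)) (G : Policy S U) : Policy S U where
  toFun u s := if s ∈ marginalSupport f then f.1 (s, u) / marginal f s else G u s
  nonneg u s := by
    split_ifs with h
    · exact div_nonneg (f.2.1 (s, u)) (le_of_lt h)
    · exact G.nonneg u s
  sum_eq_one s := by
    split_ifs with h
    · rw [← Finset.sum_div]
      exact div_self (ne_of_gt h)
    · exact G.sum_eq_one s

end EntropyProgram

end Surveillance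

end

open Surveillance

/-! The slope of `-x ln x` is infinite at `0`, so an entropy maximizer charges every state-action
pair charged by some feasible distribution (`IsOptimal.pos_of_isFeasible`). If `a` is safe and
recurrent under a policy `K`, a stationary distribution of `K` carried by the states reachable from
`a`, multiplied by `K`, is feasible and charges `(a, u)` for each action `u` that `K` uses at `a`
(`exists_isFeasible_pos`). Hence the optimal `f` charges all these pairs.

Two consequences follow. The marginal of `f` is stationary for the derived policy and vanishes on
`F`, so its support consists of safe recurrent states, and it contains every state that is safe and
recurrent under any policy (`safeRecurrent_derivedPolicy`). Moreover, every transition of `K` out of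
such a state is a transition of the derived policy (`step_derivedPolicy`), so classes can only
merge. A robot under `K` covers states of a single class of `K`, hence of a single class of the
derived policy, which bounds the number of robots from below (`numSafeClasses_le_of_iUnion_eq`). -/

namespace Surveillance

variable {S U : Type*} [Fintype S] [Fintype U] (Q : Dynamics S U) (K : Policy S U)

/-! ### The killed transition matrix -/

open scoped Classical in
/-- The transition matrix of the closed-loop chain, killed upon entering `A`. -/
noncomputable def killed (A : Set S) : Matrix S S ℝ :=
  fun s s' => if s' ∈ A then 0 else closedLoop Q K s' s

theorem killed_nonneg (A : Set S) (s s' : S) : 0 ≤ killed Q K A s s' := by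
  unfold killed
  split_ifs
  exacts [le_rfl, closedLoop_nonneg Q K s' s]

open scoped Classical in
theorem killed_pow_nonneg (A : Set S) (n : ℕ) (s s' : S) : 0 ≤ (killed Q K A ^ n) s s' := by
  induction n generalizing s' with
  | zero =>
    rw [pow_zero, Matrix.one_apply]
    split_ifs <;> norm_num
  | succ n ih =>
    rw [pow_succ, Matrix.mul_apply]
    exact Finset.sum_nonneg fun y _ => mul_nonneg (ih y) (killed_nonneg Q K A y s')

theorem measurableSet_avoid {S : Type*} [MeasurableSpace S] [DiscreteMeasurableSpace S]
    (A : Set S) (n : ℕ) :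
    MeasurableSet {ω : ℕ → S | ∀ k, 0 < k → k ≤ n → ω k ∉ A} := by
  have : {ω : ℕ → S | ∀ k, 0 < k → k ≤ n → ω k ∉ A} =
      ⋂ k, ⋂ (_ : 0 < k), ⋂ (_ : k ≤ n), (fun ω : ℕ → S => ω k) ⁻¹' Aᶜ := by
    ext; simp
  rw [this]
  exact MeasurableSet.iInter fun k => MeasurableSet.iInter fun _ => MeasurableSet.iInter fun _ =>
    measurable_pi_apply k MeasurableSet.of_discrete

theorem measurableSet_avoid_and_eq {S : Type*} [MeasurableSpace S] [DiscreteMeasurableSpace S]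
    (A : Set S) (n : ℕ) (x : S) :
    MeasurableSet {ω : ℕ → S | (∀ k, 0 < k → k ≤ n → ω k ∉ A) ∧ ω n = x} :=
  (measurableSet_avoid A n).inter
    (measurable_pi_apply (X := fun _ : ℕ => S) n (MeasurableSet.of_discrete (s := {x})))

theorem setOf_forall_ne_eq_iInter {S : Type*} (a : S) :
    {ω : ℕ → S | ∀ k > 0, ω k ≠ a} =
    ⋂ n, {ω : ℕ → S | ∀ k, 0 < k → k ≤ n → ω k ∉ ({a} : Set S)} := by
  ext ω
  simp only [Set.mem_ofPred_eq, Set.mem_iInter, Set.mem_singleton_iff]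
  exact ⟨fun h _ k hk _ => h k hk, fun h k hk => h k k hk le_rfl⟩

open scoped Classical in
theorem sum_killed_pow_succ (A : Set S) (n : ℕ) (s : S) :
    ∑ x, (killed Q K A ^ (n + 1)) s x =
      ∑ y, killed Q K A s y * ∑ x, (killed Q K A ^ n) y x := by
  simp_rw [pow_succ', Matrix.mul_apply, Finset.mul_sum]
  exact Finset.sum_comm

/-- One step of the chain from `s` to `s'` has positive probability. -/
def Step (s s' : S) : Prop := 0 < closedLoop Q K s' s

/-- `s'` can be reached from `s` in a positive number of steps. -/
def Reach : S → S → Prop := Relation.TransGen (Step Q K)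

/-! ### Trajectory law and hitting probabilities -/

section Law

variable [MeasurableSpace S] [DiscreteMeasurableSpace S]

instance isProbabilityMeasure_chainLaw (s : S) : IsProbabilityMeasure (chainLaw Q K s) := by
  unfold chainLaw; infer_instance

theorem chainLaw_start (s x : S) [Decidable (s = x)] :
    chainLaw Q K s {ω | ω 0 = x} = if s = x then 1 else 0 := by
  have h := Kernel.traj_map_frestrictLe_apply (X := fun _ => S) (κ := stepKernel Q K) 0 0
    (fun _ => s)
  rw [Kernel.partialTraj_self, Kernel.id_apply] at h
  have hB : MeasurableSet {h : Finset.Iic 0 → S | h ⟨0, Finset.mem_Iic.2 le_rfl⟩ = x} :=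
    MeasurableSet.of_discrete
  have h2 := congrArg (fun μ => μ {h : Finset.Iic 0 → S | h ⟨0, Finset.mem_Iic.2 le_rfl⟩ = x}) h
  rw [Measure.map_apply (by fun_prop) hB, Measure.dirac_apply' _ hB] at h2
  refine h2.trans ?_
  simp [Set.indicator_apply]

/-- The Markov property: `stepKernel` reads only the last coordinate of the history, so integrating
it over the avoidance event splits according to the value of `ω n`. Time `n + 1` is left
unconstrained. -/
theorem chainLaw_step (s x : S) (A : Set S) (n : ℕ) :
    chainLaw Q K s {ω | (∀ k, 0 < k → k ≤ n → ω k ∉ A) ∧ ω (n + 1) = x} =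
      ∑ y, chainLaw Q K s {ω | (∀ k, 0 < k → k ≤ n → ω k ∉ A) ∧ ω n = y} *
        ENNReal.ofReal (closedLoop Q K x y) := by
  have h := Kernel.partialTraj_compProd_eq_map_traj (X := fun _ => S) (κ := stepKernel Q K)
    (Nat.zero_le n) (x₀ := fun _ => s)
  set B : Set (Finset.Iic n → S) := {h | ∀ k : Finset.Iic n, 0 < k.1 → h k ∉ A} with hB
  have mB : MeasurableSet B := MeasurableSet.of_discrete
  have mx : MeasurableSet ({x} : Set S) := MeasurableSet.of_discrete
  have h2 := congrArg (fun μ => μ (B ×ˢ ({x} : Set S))) h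
  rw [Measure.map_apply (by fun_prop) (mB.prod mx), Measure.compProd_apply_prod mB mx,
    ← Kernel.traj_map_frestrictLe_apply, setLIntegral_map mB (Measurable.of_discrete)
      (by fun_prop)] at h2
  have e1 : {ω : ℕ → S | (∀ k, 0 < k → k ≤ n → ω k ∉ A) ∧ ω (n + 1) = x} =
      (fun ω : ℕ → S => (Preorder.frestrictLe n ω, ω (n + 1))) ⁻¹' (B ×ˢ ({x} : Set S)) := by
    ext ω
    simp only [hB, Set.mem_ofPred_eq, Set.mem_preimage, Set.mem_prod, Set.mem_singleton_iff,
      Subtype.forall, Finset.mem_Iic, Preorder.frestrictLe_apply]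
    exact and_congr_left fun _ => ⟨fun h a b c => h a c b, fun h a b c => h a c b⟩
  have e2 : {ω : ℕ → S | ∀ k, 0 < k → k ≤ n → ω k ∉ A} =
      (Preorder.frestrictLe (π := fun _ => S) n) ⁻¹' B := by
    ext ω
    simp only [hB, Set.mem_ofPred_eq, Set.mem_preimage,
      Subtype.forall, Finset.mem_Iic, Preorder.frestrictLe_apply]
    exact ⟨fun h a b c => h a c b, fun h a b c => h a c b⟩
  rw [e1]
  refine h2.symm.trans ?_
  have e3 : ∀ ω : ℕ → S, stepKernel Q K n (Preorder.frestrictLe n ω) {x} =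
      ∑ y, Set.indicator {ω : ℕ → S | ω n = y}
        (fun _ => ENNReal.ofReal (closedLoop Q K x y)) ω := by
    intro ω
    rw [Finset.sum_eq_single (ω n)]
    · simp only [Set.mem_ofPred_eq, Set.indicator_of_mem]
      exact (PMF.toMeasure_apply_singleton _ _ mx).trans rfl
    · intro y _ hy
      simp [hy.symm]
    · simp
  have my : ∀ y : S, MeasurableSet {ω : ℕ → S | ω n = y} := fun y =>
    measurable_pi_apply (X := fun _ : ℕ => S) n (MeasurableSet.of_discrete (s := {y}))
  simp_rw [e3]
  rw [lintegral_finsetSum _ fun y _ => measurable_const.indicator (my y), ← e2]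
  refine Finset.sum_congr rfl fun y _ => ?_
  rw [lintegral_indicator (my y), Measure.restrict_restrict (my y), setLIntegral_const, mul_comm,
    Set.inter_comm]
  rfl

-- Only entries into `A` are killed, never the starting state; this matches the `k > 0` in
-- `hitProb`.
open scoped Classical in
theorem chainLaw_avoid_and_eq (s x : S) (A : Set S) (n : ℕ) :
    chainLaw Q K s {ω | (∀ k, 0 < k → k ≤ n → ω k ∉ A) ∧ ω n = x} =
      ENNReal.ofReal ((killed Q K A ^ n) s x) := by
  induction n generalizing x with
  | zero =>
    have : {ω : ℕ → S | (∀ k, 0 < k → k ≤ 0 → ω k ∉ A) ∧ ω 0 = x} = {ω | ω 0 = x} := by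
      ext ω
      simp only [Set.mem_ofPred_eq, and_iff_right_iff_imp]
      intro _ k h1 h2
      omega
    rw [this, chainLaw_start, pow_zero, Matrix.one_apply]
    split_ifs <;> simp
  | succ n ih =>
    rw [pow_succ, Matrix.mul_apply]
    by_cases hx : x ∈ A
    · have : {ω : ℕ → S | (∀ k, 0 < k → k ≤ n + 1 → ω k ∉ A) ∧ ω (n + 1) = x} = ∅ := by
        ext ω
        simp only [Set.mem_ofPred_eq, Set.mem_empty_iff_false, iff_false]
        rintro ⟨h, rfl⟩
        exact h _ n.succ_pos le_rfl hx
      simp [this, killed, hx]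
    · have : {ω : ℕ → S | (∀ k, 0 < k → k ≤ n + 1 → ω k ∉ A) ∧ ω (n + 1) = x} =
          {ω | (∀ k, 0 < k → k ≤ n → ω k ∉ A) ∧ ω (n + 1) = x} := by
        ext ω
        refine and_congr_left fun h => ⟨fun h a b c => h a b (by omega), fun h' a b c => ?_⟩
        rcases Nat.le_succ_iff.1 c with c | rfl
        · exact h' a b c
        · exact h ▸ hx
      rw [this, chainLaw_step, ENNReal.ofReal_sum_of_nonneg fun y _ =>
        mul_nonneg (killed_pow_nonneg Q K A n s y) (killed_nonneg Q K A y x)]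
      refine Finset.sum_congr rfl fun y _ => ?_
      rw [ih, ENNReal.ofReal_mul (killed_pow_nonneg Q K A n s y)]
      simp [killed, hx]

open scoped Classical in
theorem chainLaw_real_avoid (s : S) (A : Set S) (n : ℕ) :
    (chainLaw Q K s).real {ω | ∀ k, 0 < k → k ≤ n → ω k ∉ A} =
      ∑ x, (killed Q K A ^ n) s x := by
  have e : {ω : ℕ → S | ∀ k, 0 < k → k ≤ n → ω k ∉ A} =
      ⋃ x ∈ (Finset.univ : Finset S),
        {ω | (∀ k, 0 < k → k ≤ n → ω k ∉ A) ∧ ω n = x} := by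
    ext; simp
  rw [e, measureReal_biUnion_finset]
  · refine Finset.sum_congr rfl fun x _ => ?_
    rw [measureReal_def, chainLaw_avoid_and_eq, ENNReal.toReal_ofReal (killed_pow_nonneg Q K A n s x)]
  · intro x _ y _ hxy
    refine Set.disjoint_left.2 fun ω h1 h2 => hxy (h1.2.symm.trans h2.2)
  · exact fun x _ => measurableSet_avoid_and_eq A n x

/-- The probability that the chain started at `s` never visits `a` at a positive time. -/
noncomputable def neverHit (a s : S) : ℝ :=
  (chainLaw Q K s).real {ω | ∀ k > 0, ω k ≠ a}

theorem neverHit_nonneg (a s : S) : 0 ≤ neverHit Q K a s := measureReal_nonneg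

theorem hitProb_eq_one_iff (s a : S) : hitProb Q K s a = 1 ↔ neverHit Q K a s = 0 := by
  have e : {ω : ℕ → S | ∃ k > 0, ω k = a} = {ω : ℕ → S | ∀ k > 0, ω k ≠ a}ᶜ := by
    ext; simp
  have m : MeasurableSet {ω : ℕ → S | ∀ k > 0, ω k ≠ a} := by
    rw [setOf_forall_ne_eq_iInter]
    exact MeasurableSet.iInter fun n => measurableSet_avoid _ n
  rw [hitProb, e, prob_compl_eq_one_iff m, neverHit, measureReal_eq_zero_iff]

open scoped Classical in
theorem tendsto_neverHit (a s : S) :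
    Filter.Tendsto (fun n => ∑ x, (killed Q K {a} ^ n) s x) Filter.atTop
      (nhds (neverHit Q K a s)) := by
  have h := tendsto_measure_iInter_atTop (μ := chainLaw Q K s)
    (s := fun n => {ω : ℕ → S | ∀ k, 0 < k → k ≤ n → ω k ∉ ({a} : Set S)})
    (fun n => (measurableSet_avoid _ n).nullMeasurableSet)
    (fun m n hmn ω h k h1 h2 => h k h1 (h2.trans hmn)) ⟨0, measure_ne_top _ _⟩
  rw [← setOf_forall_ne_eq_iInter] at h
  have h2 := (ENNReal.tendsto_toReal (measure_ne_top _ _)).comp h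
  refine h2.congr fun n => ?_
  exact chainLaw_real_avoid Q K s {a} n

/-- First-step analysis, obtained by letting `n` tend to infinity in `sum_killed_pow_succ`. -/
theorem neverHit_eq_sum (a s : S) :
    neverHit Q K a s = ∑ y, killed Q K {a} s y * neverHit Q K a y := by
  classical
  refine tendsto_nhds_unique ((tendsto_neverHit Q K a s).comp (Filter.tendsto_add_atTop_nat 1)) ?_
  simp only [Function.comp_def, sum_killed_pow_succ]
  exact tendsto_finsetSum _ fun y _ => (tendsto_neverHit Q K a y).const_mul _

/-- No path from `s` enters `a`, so the killed chain loses no mass. -/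
theorem neverHit_eq_one_of_not_reach {a s : S} (h : ¬ Reach Q K s a) : neverHit Q K a s = 1 := by
  classical
  have key : ∀ n, ∀ s, ¬ Reach Q K s a → ∑ x, (killed Q K {a} ^ n) s x = 1 := by
    intro n
    induction n with
    | zero => intro s _; simp [Matrix.one_apply]
    | succ n ih =>
      intro s hs
      rw [sum_killed_pow_succ, ← sum_closedLoop Q K s]
      refine Finset.sum_congr rfl fun y _ => ?_
      by_cases hy : Step Q K s y
      · have : y ≠ a := by
          rintro rfl
          exact hs (.single hy)
        rw [ih y fun h => hs (.head hy h)]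
        simp [killed, this]
      · have : closedLoop Q K y s = 0 :=
          le_antisymm (not_lt.1 hy) (closedLoop_nonneg Q K y s)
        simp [killed, this]
  exact tendsto_nhds_unique (tendsto_neverHit Q K a s)
    (tendsto_const_nhds.congr fun n => (key n s h).symm)

theorem reach_of_hitProb_eq_one {s a : S} (h : hitProb Q K s a = 1) : Reach Q K s a := by
  by_contra h'
  have := neverHit_eq_one_of_not_reach Q K h'
  rw [(hitProb_eq_one_iff Q K s a).1 h] at this
  exact zero_ne_one this

/-- In the first-step equation a sum of nonnegative terms vanishes, so every successor other than
`a` also misses `a` with probability zero; recurrence settles the successor `a`. -/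
theorem hitProb_eq_one_of_step {a s s' : S} (ha : a ∈ recurrent Q K) (hs : hitProb Q K s a = 1)
    (h : Step Q K s s') : hitProb Q K s' a = 1 := by
  by_cases e : s' = a
  · exact e ▸ ha
  rw [hitProb_eq_one_iff, neverHit_eq_sum, Finset.sum_eq_zero_iff_of_nonneg fun y _ =>
    mul_nonneg (killed_nonneg Q K _ s y) (neverHit_nonneg Q K a y)] at hs
  have := hs s' (Finset.mem_univ _)
  rw [hitProb_eq_one_iff]
  refine (mul_eq_zero.1 this).resolve_left ?_
  simpa [killed, e] using h.ne'

theorem hitProb_eq_one_of_reach {a s s' : S} (ha : a ∈ recurrent Q K) (hs : hitProb Q K s a = 1)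
    (h : Reach Q K s s') : hitProb Q K s' a = 1 := by
  induction h with
  | single h => exact hitProb_eq_one_of_step Q K ha hs h
  | tail _ h ih => exact hitProb_eq_one_of_step Q K ha ih h

/-- A state charged by a stationary measure is recurrent. -/
theorem mem_recurrent_of_stationary {π : S → ℝ}
    (hπ : ∀ s', ∑ s, closedLoop Q K s' s * π s = π s') {a : S} (ha : 0 < π a) :
    a ∈ recurrent Q K := by
  classical
  -- Pairing the first-step equation with `π` and using stationarity reproduces the same sum without
  -- its term at `a`. Hence `π a * neverHit Q K a a = 0`.
  have h : ∑ s, π s * neverHit Q K a s = ∑ y, if y = a then 0 else π y * neverHit Q K a y := by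
    calc ∑ s, π s * neverHit Q K a s
        = ∑ s, ∑ y, π s * (killed Q K {a} s y * neverHit Q K a y) := by
          refine Finset.sum_congr rfl fun s _ => ?_
          rw [neverHit_eq_sum, Finset.mul_sum]
      _ = ∑ y, if y = a then 0 else π y * neverHit Q K a y := by
          rw [Finset.sum_comm]
          refine Finset.sum_congr rfl fun y _ => ?_
          by_cases e : y = a
          · simp [killed, e]
          · rw [if_neg e, ← hπ y, Finset.sum_mul]
            refine Finset.sum_congr rfl fun s _ => ?_
            simp only [killed, Set.mem_singleton_iff, e, if_false]
            ring
  rw [← Finset.sum_erase_add _ _ (Finset.mem_univ a),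
    ← Finset.sum_erase_add (a := a) _ _ (Finset.mem_univ a), if_pos rfl,
    Finset.sum_congr rfl (g := fun y => if y = a then 0 else π y * neverHit Q K a y)
      (fun y hy => (if_neg (Finset.ne_of_mem_erase hy)).symm), add_right_inj] at h
  exact (hitProb_eq_one_iff Q K a a).2 ((mul_eq_zero.1 h).resolve_left ha.ne')

/-! ### Safety -/

open scoped Classical in
theorem isSafe_iff {F : Set S} {s : S} :
    IsSafe Q K F s ↔ ∀ n, ∀ x ∈ F, (killed Q K ∅ ^ n) s x = 0 := by
  -- With `A = ∅` nothing is killed, so the matrix powers are the plain `n`-step transition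
  -- probabilities.
  have e : {ω : ℕ → S | ∃ k, ω k ∈ F} =
      ⋃ n, ⋃ x ∈ F, {ω | (∀ k, 0 < k → k ≤ n → ω k ∉ (∅ : Set S)) ∧ ω n = x} := by
    ext; simp
  rw [IsSafe, e, measure_iUnion_null_iff]
  refine forall_congr' fun n => ?_
  rw [measure_biUnion_null_iff F.to_countable]
  refine forall₂_congr fun x _ => ?_
  rw [chainLaw_avoid_and_eq, ENNReal.ofReal_eq_zero]
  exact ⟨fun h => le_antisymm h (killed_pow_nonneg Q K ∅ n s x), le_of_eq⟩

theorem IsSafe.notMem {F : Set S} {s : S} (h : IsSafe Q K F s) : s ∉ F := by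
  classical
  intro hs
  have := (isSafe_iff Q K).1 h 0 s hs
  simp at this

theorem IsSafe.of_step {F : Set S} {s s' : S} (h : IsSafe Q K F s) (hs : Step Q K s s') :
    IsSafe Q K F s' := by
  classical
  rw [isSafe_iff] at h ⊢
  intro n x hx
  have h1 := h (n + 1) x hx
  rw [pow_succ', Matrix.mul_apply, Finset.sum_eq_zero_iff_of_nonneg fun y _ =>
    mul_nonneg (killed_nonneg Q K _ s y) (killed_pow_nonneg Q K _ n y x)] at h1
  refine (mul_eq_zero.1 (h1 s' (Finset.mem_univ _))).resolve_left ?_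
  simpa [killed] using hs.ne'

theorem IsSafe.of_reach {F : Set S} {s s' : S} (h : IsSafe Q K F s) (hs : Reach Q K s s') :
    IsSafe Q K F s' := by
  induction hs with
  | single h' => exact h.of_step Q K h'
  | tail _ h' ih => exact ih.of_step Q K h'

theorem isSafe_of_closed {F C : Set S} (hC : ∀ s ∈ C, ∀ s', Step Q K s s' → s' ∈ C)
    (hF : ∀ s ∈ C, s ∉ F) {s : S} (hs : s ∈ C) : IsSafe Q K F s := by
  classical
  rw [isSafe_iff]
  have : ∀ n, ∀ s ∈ C, ∀ x ∈ F, (killed Q K ∅ ^ n) s x = 0 := by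
    intro n
    induction n with
    | zero =>
      intro s hs x hx
      rw [pow_zero, Matrix.one_apply, if_neg]
      rintro rfl
      exact hF s hs hx
    | succ n ih =>
      intro s hs x hx
      rw [pow_succ', Matrix.mul_apply]
      refine Finset.sum_eq_zero fun y _ => ?_
      by_cases hy : Step Q K s y
      · rw [ih y (hC s hs y hy) x hx, mul_zero]
      · have : closedLoop Q K y s = 0 :=
          le_antisymm (not_lt.1 hy) (closedLoop_nonneg Q K y s)
        simp [killed, this]
  exact fun n => this n s hs

end Law

/-! ### Stationary distributions -/

/-- The constant vector is a right eigenvector for `1`, so there is a left one `v`. Entrywise `|v| ≤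
|v| T`, and both sides have the same total, so `|v|` is itself invariant and can be normalized. -/
theorem _root_.Matrix.exists_stationary_of_mem_rowStochastic {n : Type*} [Fintype n]
    [DecidableEq n] [Nonempty n] {T : Matrix n n ℝ} (hT : T ∈ Matrix.rowStochastic ℝ n) :
    ∃ w : n → ℝ, (∀ i, 0 ≤ w i) ∧ ∑ i, w i = 1 ∧ ∀ j, ∑ i, T i j * w i = w j := by
  have hdet : (T - 1).det = 0 := by
    refine Matrix.exists_mulVec_eq_zero_iff.1 ⟨1, one_ne_zero, ?_⟩
    rw [Matrix.sub_mulVec, hT.2, Matrix.one_mulVec, sub_self]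
  obtain ⟨v, hv0, hv⟩ := Matrix.exists_vecMul_eq_zero_iff.2 hdet
  rw [Matrix.vecMul_sub, Matrix.vecMul_one, sub_eq_zero] at hv
  have hv' : ∀ j, ∑ i, v i * T i j = v j := fun j => congrFun hv j
  have hle : ∀ j ∈ Finset.univ, |v j| ≤ ∑ i, |v i| * T i j := fun j _ => by
    rw [← hv' j]
    refine (Finset.abs_sum_le_sum_abs _ _).trans_eq (Finset.sum_congr rfl fun i _ => ?_)
    rw [abs_mul, abs_of_nonneg (hT.1 i j)]
  have hsum : ∑ j, |v j| = ∑ j, ∑ i, |v i| * T i j := by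
    rw [Finset.sum_comm]
    refine Finset.sum_congr rfl fun i _ => ?_
    rw [← Finset.mul_sum, Matrix.sum_row_of_mem_rowStochastic hT, mul_one]
  have heq := (Finset.sum_eq_sum_iff_of_le hle).1 hsum
  obtain ⟨i, hi⟩ := Function.ne_iff.1 hv0
  have hpos : 0 < ∑ i, |v i| :=
    Finset.sum_pos' (fun i _ => abs_nonneg _) ⟨i, Finset.mem_univ _, abs_pos.2 hi⟩
  refine ⟨fun i => |v i| / ∑ i, |v i|, fun i => by positivity, ?_, fun j => ?_⟩
  · rw [← Finset.sum_div, div_self hpos.ne']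
  · beta_reduce
    rw [heq j (Finset.mem_univ j), Finset.sum_div]
    exact Finset.sum_congr rfl fun i _ => by ring

/-- Every nonempty closed set of states carries a stationary distribution. -/
theorem exists_stationary {C : Set S} (hne : C.Nonempty)
    (hC : ∀ s ∈ C, ∀ s', Step Q K s s' → s' ∈ C) :
    ∃ π : S → ℝ, (∀ s, 0 ≤ π s) ∧ (∀ s ∉ C, π s = 0) ∧ ∑ s, π s = 1 ∧
      ∀ s', ∑ s, closedLoop Q K s' s * π s = π s' := by
  classical
  have := hne.to_subtype
  -- No mass leaves `C`, so the matrix restricted to `C` is still stochastic; its stationary vector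
  -- is then extended by zero.
  have hzero : ∀ s ∈ C, ∀ s' ∉ C, closedLoop Q K s' s = 0 := fun s hs s' hs' =>
    le_antisymm (not_lt.1 fun h => hs' (hC s hs s' h)) (closedLoop_nonneg Q K s' s)
  have hT : (Matrix.of fun i j : C => closedLoop Q K j i) ∈ Matrix.rowStochastic ℝ C := by
    refine Matrix.mem_rowStochastic_iff_sum.2 ⟨fun i j => closedLoop_nonneg Q K j i, fun i => ?_⟩
    rw [← sum_closedLoop Q K i, ← Finset.sum_subset (Finset.subset_univ (Finset.univ.filter (· ∈ C)))
      fun s _ hs => hzero i i.2 s (by simpa using hs)]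
    exact (Finset.sum_subtype _ (by simp) fun s => closedLoop Q K s i).symm
  obtain ⟨w, hw0, hw1, hw⟩ := Matrix.exists_stationary_of_mem_rowStochastic hT
  have hsum : ∀ g : S → ℝ, ∑ s, g s * (∑ c : C, if (c : S) = s then w c else 0) =
      ∑ c : C, g c * w c := by
    intro g
    simp_rw [Finset.mul_sum]
    rw [Finset.sum_comm]
    simp
  have hmem : ∀ c : C, (∑ c' : C, if (c' : S) = c then w c' else 0) = w c := by
    intro c
    simp [Subtype.coe_inj]
  have hnot : ∀ s ∉ C, (∑ c : C, if (c : S) = s then w c else 0) = 0 := fun s hs =>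
    Finset.sum_eq_zero fun c _ => if_neg (ne_of_mem_of_not_mem c.2 hs)
  refine ⟨fun s => ∑ c : C, if (c : S) = s then w c else 0, fun s => ?_, hnot, ?_, fun s' => ?_⟩
  · refine Finset.sum_nonneg fun c _ => ?_
    split_ifs
    exacts [hw0 c, le_rfl]
  · simpa [hw1] using hsum 1
  · rw [hsum]
    by_cases hs' : s' ∈ C
    · exact (hw ⟨s', hs'⟩).trans (hmem ⟨s', hs'⟩).symm
    · refine Eq.trans ?_ (hnot s' hs').symm
      exact Finset.sum_eq_zero fun c _ => by rw [hzero c c.2 s' hs', zero_mul]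

variable {Q K}

theorem stationary_pos_of_step {π : S → ℝ} (h0 : ∀ s, 0 ≤ π s)
    (hπ : ∀ s', ∑ s, closedLoop Q K s' s * π s = π s') {s s' : S} (hs : 0 < π s)
    (h : Step Q K s s') : 0 < π s' := by
  rw [← hπ s']
  exact Finset.sum_pos' (fun x _ => mul_nonneg (closedLoop_nonneg Q K s' x) (h0 x))
    ⟨s, Finset.mem_univ _, mul_pos h hs⟩

theorem stationary_pos_of_reach {π : S → ℝ} (h0 : ∀ s, 0 ≤ π s)
    (hπ : ∀ s', ∑ s, closedLoop Q K s' s * π s = π s') {s s' : S} (hs : 0 < π s)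
    (h : Reach Q K s s') : 0 < π s' := by
  induction h with
  | single h => exact stationary_pos_of_step h0 hπ hs h
  | tail _ h ih => exact stationary_pos_of_step h0 hπ ih h

/-! ### Recurrent classes as reachability classes -/

section Recurrent

variable [MeasurableSpace S] [DiscreteMeasurableSpace S]

/-- A stationary distribution on the states reachable from `a` charges some `x`; since `x` leads
back to `a`, positivity propagates to `a`. -/
theorem exists_stationary_pos {a : S} (ha : a ∈ recurrent Q K) :
    ∃ π : S → ℝ, (∀ s, 0 ≤ π s) ∧ (∀ s, ¬ Reach Q K a s → π s = 0) ∧ ∑ s, π s = 1 ∧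
      (∀ s', ∑ s, closedLoop Q K s' s * π s = π s') ∧ 0 < π a := by
  obtain ⟨π, h0, hC, h1, hπ⟩ := exists_stationary Q K (C := {s | Reach Q K a s})
    ⟨a, reach_of_hitProb_eq_one Q K ha⟩ fun s hs s' h => Relation.TransGen.tail hs h
  refine ⟨π, h0, hC, h1, hπ, ?_⟩
  obtain ⟨x, -, hx⟩ := Finset.exists_ne_zero_of_sum_ne_zero (h1.trans_ne one_ne_zero)
  have hax : Reach Q K a x := not_not.1 fun h => hx (hC x h)
  exact stationary_pos_of_reach h0 hπ (lt_of_le_of_ne (h0 x) hx.symm)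
    (reach_of_hitProb_eq_one Q K (hitProb_eq_one_of_reach Q K ha ha hax))

theorem mem_recurrent_of_reach {a x : S} (ha : a ∈ recurrent Q K) (h : Reach Q K a x) :
    x ∈ recurrent Q K := by
  obtain ⟨π, h0, -, -, hπ, hpos⟩ := exists_stationary_pos ha
  exact mem_recurrent_of_stationary Q K hπ (stationary_pos_of_reach h0 hπ hpos h)

theorem reach_symm {a x : S} (ha : a ∈ recurrent Q K) (h : Reach Q K a x) : Reach Q K x a :=
  reach_of_hitProb_eq_one Q K (hitProb_eq_one_of_reach Q K ha ha h)

theorem surveilled_eq {a : S} (ha : a ∈ recurrent Q K) :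
    surveilled Q K a = {x | Reach Q K a x} := by
  ext x
  refine ⟨fun h => reach_of_hitProb_eq_one Q K h.2, fun h => ?_⟩
  have hx := mem_recurrent_of_reach ha h
  exact ⟨hx, hitProb_eq_one_of_reach Q K hx hx (reach_symm ha h)⟩

variable {F : Set S}

theorem safeSurveilled_eq {a : S} (ha : a ∈ safeRecurrent Q K F) :
    safeSurveilled Q K F a = {x | Reach Q K a x} := by
  ext x
  refine ⟨fun h => reach_of_hitProb_eq_one Q K h.1.2, fun h => ⟨?_, ha.2.of_reach Q K h⟩⟩
  rw [surveilled_eq ha.1]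
  exact h

theorem mem_safeRecurrent_of_reach {a x : S} (ha : a ∈ safeRecurrent Q K F)
    (h : Reach Q K a x) : x ∈ safeRecurrent Q K F :=
  ⟨mem_recurrent_of_reach ha.1 h, ha.2.of_reach Q K h⟩

theorem safeSurveilled_subset (s : S) : safeSurveilled Q K F s ⊆ safeRecurrent Q K F :=
  fun _ h => ⟨h.1.1, h.2⟩

theorem mem_safeSurveilled_self {a : S} (ha : a ∈ safeRecurrent Q K F) :
    a ∈ safeSurveilled Q K F a :=
  ⟨⟨ha.1, ha.1⟩, ha.2⟩

theorem exists_iUnion_safeSurveilled_eq (Q : Dynamics S U) (K : Policy S U) (F : Set S) :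
    ∃ s : Fin (numSafeClasses Q K F) → S,
      ⋃ i, safeSurveilled Q K F (s i) = safeRecurrent Q K F := by
  have e : Fin (numSafeClasses Q K F) ≃ safeRecurrentClasses Q K F :=
    ((Set.toFinite _).equivFin).symm
  choose s hs using fun i => (e i).2
  refine ⟨s, Set.Subset.antisymm (Set.iUnion_subset fun i => safeSurveilled_subset _) ?_⟩
  intro a ha
  refine Set.mem_iUnion.2 ⟨e.symm ⟨_, a, ha, rfl⟩, ?_⟩
  rw [← (hs _).2, Equiv.apply_symm_apply]
  exact mem_safeSurveilled_self ha

/-- If every edge of the chain under `K` is an edge of the chain under `K'`, at least as many robots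
are needed under `K` as there are classes under `K'`. -/
theorem numSafeClasses_le_of_iUnion_eq {K' : Policy S U} {r : ℕ} (s : Fin r → S)
    (hs : ⋃ i, safeSurveilled Q K F (s i) = safeRecurrent Q K' F)
    (hstep : ∀ x ∈ safeRecurrent Q K F, ∀ y, Step Q K x y → Step Q K' x y) :
    numSafeClasses Q K' F ≤ r := by
  have hreach : ∀ x ∈ safeRecurrent Q K F, ∀ y, Reach Q K x y → Reach Q K' x y := by
    intro x hx y h
    induction h with
    | single h => exact .single (hstep x hx _ h)
    | tail h1 h2 ih => exact ih.tail (hstep _ (mem_safeRecurrent_of_reach hx h1) _ h2)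
  -- The start `s i` need not be recurrent, so the class assigned to `i` is described through the
  -- states covered from it.
  have hsub : safeRecurrentClasses Q K' F ⊆
      Set.range fun i => {x | ∃ c ∈ safeSurveilled Q K F (s i), Reach Q K' c x} := by
    rintro _ ⟨a, ha, rfl⟩
    obtain ⟨i, hi⟩ := Set.mem_iUnion.1 (hs ▸ ha)
    refine ⟨i, ?_⟩
    rw [safeSurveilled_eq ha]
    ext x
    refine ⟨fun ⟨c, hc, hx⟩ => ?_, fun hx => ⟨a, hi, hx⟩⟩
    -- From `s i` the chain can reach `a`, and `c` is still hit almost surely from there: all states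
    -- covered by one robot communicate.
    have hac : Reach Q K a c := reach_of_hitProb_eq_one Q K
      (hitProb_eq_one_of_reach Q K hc.1.1 hc.1.2 (reach_of_hitProb_eq_one Q K hi.1.2))
    exact (hreach a (safeSurveilled_subset _ hi) c hac).trans hx
  calc numSafeClasses Q K' F ≤ (Set.range fun i =>
        {x | ∃ c ∈ safeSurveilled Q K F (s i), Reach Q K' c x}).ncard :=
        Set.ncard_le_ncard hsub (Set.toFinite _)
    _ ≤ r := by
        rw [← Set.image_univ]
        exact (Set.ncard_image_le (Set.toFinite _)).trans (by simp [Set.ncard_univ])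

theorem safeRecurrentClasses_subset : safeRecurrentClasses Q K F ⊆ recurrentClasses Q K := by
  rintro _ ⟨a, ha, rfl⟩
  exact ⟨a, ha.1, by rw [safeSurveilled_eq ha, surveilled_eq ha.1]⟩

theorem recurrentClasses_eq (h : recurrent Q K = safeRecurrent Q K F) :
    recurrentClasses Q K = safeRecurrentClasses Q K F := by
  refine Set.Subset.antisymm ?_ safeRecurrentClasses_subset
  rintro _ ⟨a, ha, rfl⟩
  exact ⟨a, h ▸ ha, by rw [safeSurveilled_eq (h ▸ ha), surveilled_eq ha]⟩

end Recurrent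

/-! ### The entropy maximizer and its policy -/

section Entropy

/-- If `f p = 0`, moving from `f` a fraction `t` towards `g` gains `-t ln t * g p` at `p`, while by
concavity the remaining change is at least of order `-t`. For small `t` the gain wins. -/
theorem IsOptimal.pos_of_isFeasible {F : Set S} {f g : stdSimplex ℝ (S × U)} (hf : IsOptimal Q F f)
    (hg : IsFeasible Q F g) {p : S × U} (hp : 0 < g.1 p) : 0 < f.1 p := by
  classical
  by_contra hfp
  replace hfp : f.1 p = 0 := le_antisymm (not_lt.1 hfp) (f.2.1 p)
  have entropy_eq : ∀ h : stdSimplex ℝ (S × U), entropy h = ∑ q, Real.negMulLog (h.1 q) :=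
    fun h => (Fintype.sum_prod_type_right fun q => Real.negMulLog (h.1 q)).symm
  have key : ∀ t : ℝ, 0 < t → t < 1 → entropy g - entropy f + -Real.log t * g.1 p ≤ 0 := by
    intro t ht0 ht1
    have hmem := (convex_stdSimplex ℝ (S × U)) f.2 g.2 (sub_nonneg.2 ht1.le) ht0.le
      (sub_add_cancel 1 t)
    set h : stdSimplex ℝ (S × U) := ⟨_, hmem⟩ with hh
    have hval : ∀ q, h.1 q = (1 - t) * f.1 q + t * g.1 q := fun q => rfl
    have hfeas : IsFeasible Q F h := by
      refine ⟨fun s' => ?_, fun s hs => ?_⟩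
      · simp only [hval, mul_add, Finset.sum_add_distrib, ← Finset.mul_sum, hf.1.1 s', hg.1 s',
          mul_left_comm (Q _ _ _)]
      · simp only [hval, Finset.sum_add_distrib, ← Finset.mul_sum, hf.1.2 s hs, hg.2 s hs,
          mul_zero, add_zero]
    have hle := hf.2 h hfeas
    have hlow : (1 - t) * entropy f + t * entropy g + -(t * Real.log t * g.1 p) ≤ entropy h := by
      rw [entropy_eq h, entropy_eq f, entropy_eq g, Finset.mul_sum, Finset.mul_sum,
        ← Finset.sum_add_distrib, ← Finset.add_sum_erase _ _ (Finset.mem_univ p),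
        ← Finset.add_sum_erase _ (fun q => Real.negMulLog (h.1 q)) (Finset.mem_univ p),
        add_right_comm]
      refine add_le_add (le_of_eq ?_) (Finset.sum_le_sum fun q _ => ?_)
      · rw [hval, hfp, mul_zero, zero_add, Real.negMulLog_zero, mul_zero, zero_add,
          Real.negMulLog_mul]
        simp only [Real.negMulLog]
        ring
      · have := Real.concaveOn_negMulLog.2 (f.2.1 q) (g.2.1 q) (sub_nonneg.2 ht1.le) ht0.le
          (sub_add_cancel 1 t)
        simpa only [smul_eq_mul, hval] using this
    have : t * (entropy g - entropy f + -Real.log t * g.1 p) ≤ t * 0 := by linarith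
    exact le_of_mul_le_mul_left this ht0
  -- For `t = exp (-c)` the gain `-log t * g p` equals `|entropy f - entropy g| + g p`, too large
  -- for `key`.
  set c := |entropy f - entropy g| / g.1 p + 1 with hc
  have hcpos : 0 < c := by positivity
  have := key (Real.exp (-c)) (Real.exp_pos _) (Real.exp_lt_one_iff.2 (by linarith))
  rw [Real.log_exp, neg_neg, hc, add_mul, div_mul_cancel₀ _ hp.ne'] at this
  linarith [le_abs_self (entropy f - entropy g)]

theorem marginal_nonneg (f : stdSimplex ℝ (S × U)) (s : S) : 0 ≤ marginal f s :=
  Finset.sum_nonneg fun u _ => f.2.1 (s, u)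

theorem marginal_pos {f : stdSimplex ℝ (S × U)} {s : S} {u : U} (h : 0 < f.1 (s, u)) :
    0 < marginal f s :=
  Finset.sum_pos' (fun u _ => f.2.1 (s, u)) ⟨u, Finset.mem_univ _, h⟩

/-- Off the support both sides vanish, so the arbitrary policy `G` plays no role. -/
theorem derivedPolicy_mul_marginal (f : stdSimplex ℝ (S × U)) (G : Policy S U) (u : U) (s : S) :
    derivedPolicy f G u s * marginal f s = f.1 (s, u) := by
  by_cases hs : s ∈ marginalSupport f
  · have hs' : 0 < marginal f s := hs
    simp [derivedPolicy, hs, div_mul_cancel₀ _ hs'.ne']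
  · have h0 : marginal f s = 0 := le_antisymm (not_lt.1 hs) (marginal_nonneg f s)
    rw [h0, mul_zero]
    exact ((Finset.sum_eq_zero_iff_of_nonneg fun u _ => f.2.1 (s, u)).1 h0 u
      (Finset.mem_univ u)).symm

theorem derivedPolicy_pos {f : stdSimplex ℝ (S × U)} (G : Policy S U) {u : U} {s : S}
    (h : 0 < f.1 (s, u)) : 0 < derivedPolicy f G u s := by
  refine pos_of_mul_pos_left ?_ (marginal_nonneg f s)
  rwa [derivedPolicy_mul_marginal]

theorem marginal_stationary {F : Set S} {f : stdSimplex ℝ (S × U)} (hf : IsFeasible Q F f)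
    (G : Policy S U) (s' : S) :
    ∑ s, closedLoop Q (derivedPolicy f G) s' s * marginal f s = marginal f s' := by
  rw [marginal, hf.1 s']
  refine Finset.sum_congr rfl fun s _ => ?_
  simp_rw [closedLoop, Finset.sum_mul, mul_assoc, derivedPolicy_mul_marginal]

variable [MeasurableSpace S] [DiscreteMeasurableSpace S]

/-- The support of a stationary measure is closed under steps and consists of recurrent states;
feasibility keeps it off `F`. -/
theorem marginalSupport_subset {F : Set S} {f : stdSimplex ℝ (S × U)} (hf : IsFeasible Q F f)
    (G : Policy S U) : marginalSupport f ⊆ safeRecurrent Q (derivedPolicy f G) F := by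
  intro s hs
  refine ⟨mem_recurrent_of_stationary Q _ (marginal_stationary hf G) hs,
    isSafe_of_closed Q _ (C := marginalSupport f) (fun x hx y h => ?_) (fun x hx hxF => ?_) hs⟩
  · exact stationary_pos_of_step (marginal_nonneg f) (marginal_stationary hf G) hx h
  · exact (show 0 < marginal f x from hx).ne' (hf.2 x hxF)

/-- Every action taken with positive probability in a safe recurrent state is charged by some
feasible distribution. -/
theorem exists_isFeasible_pos {F : Set S} {a : S} (ha : a ∈ safeRecurrent Q K F) :
    ∃ g : stdSimplex ℝ (S × U), IsFeasible Q F g ∧ ∀ u, 0 < K u a → 0 < g.1 (a, u) := by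
  obtain ⟨π, h0, hC, h1, hπ, hpos⟩ := exists_stationary_pos ha.1
  have hmarg : ∀ s, ∑ u, π s * K u s = π s := fun s => by
    rw [← Finset.mul_sum, K.sum_eq_one, mul_one]
  refine ⟨⟨fun p => π p.1 * K p.2 p.1, fun p => mul_nonneg (h0 _) (K.nonneg _ _), ?_⟩,
    ⟨fun s' => ?_, fun s hs => ?_⟩, fun u hu => mul_pos hpos hu⟩
  · rw [Fintype.sum_prod_type]
    simp only [hmarg, h1]
  · simp only [hmarg]
    rw [← hπ s']
    refine Finset.sum_congr rfl fun s _ => ?_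
    rw [closedLoop, Finset.sum_mul]
    exact Finset.sum_congr rfl fun u _ => by ring
  · simp only [hmarg]
    -- `π` lives on states reachable from the safe state `a`, and these avoid `F`.
    exact hC s fun h => (ha.2.of_reach Q K h).notMem Q K hs

theorem pos_of_isOptimal {F : Set S} {f : stdSimplex ℝ (S × U)} (hf : IsOptimal Q F f) {a : S}
    (ha : a ∈ safeRecurrent Q K F) {u : U} (hu : 0 < K u a) : 0 < f.1 (a, u) := by
  obtain ⟨g, hg, hpos⟩ := exists_isFeasible_pos ha
  exact hf.pos_of_isFeasible hg (hpos u hu)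

theorem safeRecurrent_derivedPolicy {F : Set S} {f : stdSimplex ℝ (S × U)}
    (hf : IsOptimal Q F f) (G : Policy S U) :
    safeRecurrent Q (derivedPolicy f G) F = maxSafeRecurrent Q F := by
  refine Set.Subset.antisymm (Set.subset_iUnion (fun K => safeRecurrent Q K F) _)
    (Set.iUnion_subset fun K a ha => marginalSupport_subset hf.1 G ?_)
  obtain ⟨u, -, hu⟩ := Finset.exists_ne_zero_of_sum_ne_zero ((K.sum_eq_one a).trans_ne one_ne_zero)
  exact marginal_pos (pos_of_isOptimal hf ha (lt_of_le_of_ne (K.nonneg u a) hu.symm))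

/-- The action of `K` that produces the step is charged by `f`, so the derived policy uses it too.
-/
theorem step_derivedPolicy {F : Set S} {f : stdSimplex ℝ (S × U)}
    (hf : IsOptimal Q F f) (G : Policy S U) {a : S} (ha : a ∈ safeRecurrent Q K F) {s' : S}
    (h : Step Q K a s') : Step Q (derivedPolicy f G) a s' := by
  obtain ⟨u, -, hu⟩ := Finset.exists_ne_zero_of_sum_ne_zero h.ne'
  have hK : 0 < K u a := lt_of_le_of_ne (K.nonneg u a) (right_ne_zero_of_mul hu).symm
  have hQ : 0 < Q s' a u := lt_of_le_of_ne (Q.nonneg s' a u) (left_ne_zero_of_mul hu).symm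
  exact Finset.sum_pos' (fun v _ => mul_nonneg (Q.nonneg s' a v) ((derivedPolicy f G).nonneg v a))
    ⟨u, Finset.mem_univ _, mul_pos hQ (derivedPolicy_pos G (pos_of_isOptimal hf ha hK))⟩

end Entropy

end Surveillance

theorem proposition2 {S U : Type*} [Fintype S] [Fintype U]
    [MeasurableSpace S] [DiscreteMeasurableSpace S]
    (Q : Dynamics S U) (F : Set S) (f : stdSimplex ℝ (S × U)) (hf : IsOptimal Q F f)
    (G Kstar : Policy S U) (hKstar : Kstar = derivedPolicy f G) :
    -- `Kstar` is one of the policies with maximal set of `F`-safe recurrent states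
    Kstar ∈ maximalPolicies Q F ∧
    -- and among these it has the fewest `F`-safe recurrent classes
    (∀ K ∈ maximalPolicies Q F, numSafeClasses Q Kstar F ≤ numSafeClasses Q K F) ∧
    -- the same holds for all recurrent classes, if `Kstar` has no other recurrent states
    (recurrent Q Kstar = maxSafeRecurrent Q F →
      ∀ K ∈ maximalPolicies Q F,
        (recurrentClasses Q Kstar).ncard ≤ (recurrentClasses Q K).ncard) ∧
    -- this number of robots suffices under `Kstar`
    (∃ s : Fin (numSafeClasses Q Kstar F) → S,
      ⋃ i, safeSurveilled Q Kstar F (s i) = maxSafeRecurrent Q F) ∧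
    -- and it is the minimum number of robots over all policies
    IsLeast {r : ℕ | ∃ (K : Policy S U) (s : Fin r → S),
      ⋃ i, safeSurveilled Q K F (s i) = maxSafeRecurrent Q F} (numSafeClasses Q Kstar F) := by
  subst hKstar
  have hmax := safeRecurrent_derivedPolicy hf G
  have hle : ∀ (K : Policy S U) (r : ℕ) (s : Fin r → S),
      ⋃ i, safeSurveilled Q K F (s i) = maxSafeRecurrent Q F →
        numSafeClasses Q (derivedPolicy f G) F ≤ r := fun K r s hs =>
    numSafeClasses_le_of_iUnion_eq s (hs.trans hmax.symm)
      fun _ hx _ h => step_derivedPolicy hf G hx h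
  have hmin : ∀ K ∈ maximalPolicies Q F,
      numSafeClasses Q (derivedPolicy f G) F ≤ numSafeClasses Q K F := fun K hK => by
    obtain ⟨s, hs⟩ := exists_iUnion_safeSurveilled_eq Q K F
    exact hle K _ s (hs.trans hK)
  have hex : ∃ s : Fin (numSafeClasses Q (derivedPolicy f G) F) → S,
      ⋃ i, safeSurveilled Q (derivedPolicy f G) F (s i) = maxSafeRecurrent Q F := by
    obtain ⟨s, hs⟩ := exists_iUnion_safeSurveilled_eq Q (derivedPolicy f G) F
    exact ⟨s, hs.trans hmax⟩
  refine ⟨hmax, hmin, fun hrec K hK => ?_, hex, ⟨_, hex⟩, fun r ⟨K, s, hs⟩ => hle K r s hs⟩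
  -- All classes of the derived policy are now safe, while `K` may have unsafe ones as well, which
  -- only raises its count.
  rw [recurrentClasses_eq (hrec.trans hmax.symm)]
  exact (hmin K hK).trans (Set.ncard_le_ncard safeRecurrentClasses_subset (Set.toFinite _))
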